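/- **Definitions.** An *unbounded distributive bilattice* is a non-empty algebra $(A;\vee_t,\wedge_t,\vee_k,\wedge_k,\neg)$ such that $(A;\vee_t,\wedge_t)$ and $(A;\vee_k,\wedge_k)$ are lattices, each of the four operations $\vee_t,\wedge_t,\vee_k,\wedge_k$ distributes over each of the other three, and $\neg$ is an involution that is a dual endomorphism of $(A;\vee_t,\wedge_t)$ and an endomorphism of $(A;\vee_k,\wedge_k)$. Let $\mathcal{DB}_u$ be the class of these algebras. A *distributive bilattice* is an algebra $(A;\vee_t,\wedge_t,\neg,0_t,1_t,0_k,1_k)$ such that, with $$a\vee_k b:=((a\wedge_t b)\wedge_t 0_k)\vee_t((a\vee_t b)\wedge_t 1_k),\qquad a\wedge_k b:=((a\wedge_t b)\wedge_t 1_k)\vee_t((a\vee_t b)\wedge_t 0_k),$$ $(A;\vee_t,\wedge_t,\vee_k,\wedge_k,\neg)$ is an unbounded distributive bilattice, $0_t,1_t$ are the bottom and top of $(A;\vee_t,\wedge_t)$ and are interchanged by $\neg$, and $0_k,1_k$ are the bottom and top of $(A;\vee_k,\wedge_k)$ and are fixed by $\neg$. Let $\mathcal{DB}$ be the class of these algebras.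 A *clause* is an ordered pair $(\Sigma,\Delta)$ of finite sets of identities between terms in countably many variables; it is a *quasi-equation* if $\Delta$ has exactly one element. An algebra $A$ *satisfies* $(\Sigma,\Delta)$ if every assignment of the variables in $A$ that makes all identities in $\Sigma$ true makes at least one identity in $\Delta$ true. For $\mathcal A\in\{\mathcal{DB},\mathcal{DB}_u\}$, a clause is *valid* in $\mathcal A$ if every member of $\mathcal A$ satisfies it, and *admissible* in $\mathcal A$ if the free algebra $\mathbf F_{\mathcal A}(\aleph_0)$ of $\mathcal A$ on countably infinitely many generators satisfies it. A set $\Lambda$ of clauses is a *basis for the admissible clauses* of $\mathcal A$ if, for every $A\in\mathcal A$, $A$ satisfies all clauses in $\Lambda$ if and only if $A$ belongs to the universal class generated by $\mathbf F_{\mathcal A}(\aleph_0)$, that is, $A$ satisfies every clause that $\mathbf F_{\mathcal A}(\aleph_0)$ satisfies. **Theorem.** 1. Every quasi-equation that is admissible in $\mathcal{DB}$ is valid in $\mathcal{DB}$. 2. The three clauses $$(\{x\wedge_k y\approx 1_t\},\{x\approx 1_t,\ y\approx 1_t\}),\qquad(\{x\vee_k y\approx 1_t\},\{x\approx 1_t,\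 y\approx 1_t\}),\qquad(\{0_t\approx 1_t\},\emptyset)$$ form a basis for the admissible clauses of $\mathcal{DB}$. 3. Every clause that is admissible in $\mathcal{DB}_u$ is valid in $\mathcal{DB}_u$. -/

import Mathlib

open FirstOrder FirstOrder.Language

universe u

namespace Bilat

section Clauses

/-! ### Clauses, validity, free algebras, admissibility, bases -/

/-- An identity `s ≈ t` between terms over countably many variables. -/
abbrev Identity (L : FirstOrder.Language.{0, 0}) : Type := L.Term ℕ × L.Term ℕ

/-- A clause `(Σ, Δ)`: an ordered pair of finite sets of identities. -/
abbrev Clause (L : FirstOrder.Language.{0, 0}) : Type := Finset (Identity L) × Finset (Identity L)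

/-- A quasi-identity (quasi-equation) is a clause `(Σ, Δ)` with exactly one identity in `Δ`. -/
def Clause.IsQuasiIdentity {L : FirstOrder.Language.{0, 0}} (c : Clause L) : Prop :=
  c.2.card = 1

/-- `A` satisfies the clause `(Σ, Δ)`: under every homomorphism from the term algebra to `A`
(that is, under the evaluation of terms at any assignment `v` of the variables), if all
identities in `Σ` hold then some identity in `Δ` holds. -/
def Clause.Holds {L : FirstOrder.Language.{0, 0}} (c : Clause L) (A : Type u) [L.Structure A] : Prop :=
  ∀ v : ℕ → A, (∀ e ∈ c.1, e.1.realize v = e.2.realize v) →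
    ∃ e ∈ c.2, e.1.realize v = e.2.realize v

/-- A class of algebras in the language `L`. -/
abbrev AlgClass (L : FirstOrder.Language.{0, 0}) : Type (u + 1) :=
  ∀ (A : Type u) [L.Structure A], Prop

/-- The clause is valid in every (non-empty) algebra of the class. -/
def Clause.Valid {L : FirstOrder.Language.{0, 0}} (K : AlgClass.{u} L) (c : Clause L) : Prop :=
  ∀ (A : Type u) [L.Structure A], Nonempty A → K A → c.Holds A

/-- Two terms are identified when the identity between them is valid in the class. -/
def identitySetoid {L : FirstOrder.Language.{0, 0}} (K : AlgClass.{u} L) : Setoid (L.Term ℕ) where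
  r s t := ∀ (A : Type u) [L.Structure A], K A → ∀ v : ℕ → A, s.realize v = t.realize v
  iseqv :=
    { refl := fun _ _ _ _ _ => rfl
      symm := fun h A _ hA v => (h A hA v).symm
      trans := fun h h' A _ hA v => (h A hA v).trans (h' A hA v) }

/-- The term algebra (absolutely free algebra) over countably many variables. -/
@[reducible]
def termStructure (L : FirstOrder.Language.{0, 0}) [L.IsAlgebraic] : L.Structure (L.Term ℕ) where
  funMap f ts := Term.func f ts
  RelMap r _ := isEmptyElim r

instance identityPrestructure {L : FirstOrder.Language.{0, 0}} [L.IsAlgebraic] (K : AlgClass.{u} L) :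
    L.Prestructure (identitySetoid K) where
  toStructure := termStructure L
  fun_equiv {n} {f} x y h := by
    intro A _ hA v
    change (Term.func f x).realize v = (Term.func f y).realize v
    simp only [Term.realize]
    exact congrArg _ (funext fun i => h i A hA v)
  rel_equiv {n} {r} := isEmptyElim r

/-- The free algebra of the class on countably many generators: the term algebra over countably
many variables modulo the identities valid in the class.  The free generators are the classes
of the variables; the operations are those of `FirstOrder.Language.quotientStructure`. -/
abbrev FreeAlg {L : FirstOrder.Language.{0, 0}} (K : AlgClass.{u} L) : Type :=
  Quotient (identitySetoid K)

/-- A clause is admissible in the class if it is valid in the free algebra on countably many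
generators. -/
def Clause.Admissible {L : FirstOrder.Language.{0, 0}} [L.IsAlgebraic] (K : AlgClass.{u} L)
    (c : Clause L) : Prop :=
  c.Holds (FreeAlg K)

/-- `A` belongs to the universal class generated by `F`: every clause true in `F` is true
in `A`. -/
def InUniversalClass {L : FirstOrder.Language.{0, 0}} (F : Type) [L.Structure F]
    (A : Type u) [L.Structure A] : Prop :=
  ∀ c : Clause L, c.Holds F → c.Holds A

/-- `Λ` is a basis for the admissible clauses of the class: an algebra of the class satisfies `Λ`
if and only if it is in the universal class generated by the free algebra on countably many
generators. -/
def IsBasisAdmissibleClauses {L : FirstOrder.Language.{0, 0}} [L.IsAlgebraic] (K : AlgClass.{u} L)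
    (Λ : Set (Clause L)) : Prop :=
  ∀ (A : Type u) [L.Structure A], Nonempty A → K A →
    ((∀ c ∈ Λ, c.Holds A) ↔ InUniversalClass (L := L) (FreeAlg K) A)

end Clauses

section Laws

/-! ### Distributive (pre-)bilattices

Here `jt`, `mt`, `jk`, `mk` are the operations `∨_t`, `∧_t`, `∨_k`, `∧_k`. -/

/-- `(A; j, m)` is a lattice with join `j` and meet `m`. -/
structure IsLatticeOps {A : Type u} (j m : A → A → A) : Prop where
  join_comm : ∀ a b, j a b = j b a
  meet_comm : ∀ a b, m a b = m b a
  join_assoc : ∀ a b c, j (j a b) c = j a (j b c)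
  meet_assoc : ∀ a b c, m (m a b) c = m a (m b c)
  join_meet : ∀ a b, j a (m a b) = a
  meet_join : ∀ a b, m a (j a b) = a

/-- The (commutative) operation `f` distributes over `g`. -/
def DistribOver {A : Type u} (f g : A → A → A) : Prop :=
  ∀ a b c, f a (g b c) = g (f a b) (f a c)

/-- Unbounded distributive pre-bilattices: two lattices such that each of the four operations
distributes over each of the other three. -/
structure IsUnboundedDistribPreBilattice {A : Type u} (jt mt jk mk : A → A → A) : Prop where
  t_lattice : IsLatticeOps jt mt
  k_lattice : IsLatticeOps jk mk
  jt_mt : DistribOver jt mt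
  jt_jk : DistribOver jt jk
  jt_mk : DistribOver jt mk
  mt_jt : DistribOver mt jt
  mt_jk : DistribOver mt jk
  mt_mk : DistribOver mt mk
  jk_jt : DistribOver jk jt
  jk_mt : DistribOver jk mt
  jk_mk : DistribOver jk mk
  mk_jt : DistribOver mk jt
  mk_mt : DistribOver mk mt
  mk_jk : DistribOver mk jk

/-- Unbounded distributive bilattices: `neg` is involutory, a dual endomorphism of the `t`-lattice
and an endomorphism of the `k`-lattice. -/
structure IsUnboundedDistribBilattice {A : Type u} (jt mt jk mk : A → A → A) (neg : A → A) :
    Prop extends IsUnboundedDistribPreBilattice jt mt jk mk where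
  neg_neg : ∀ a, neg (neg a) = a
  neg_jt : ∀ a b, neg (jt a b) = mt (neg a) (neg b)
  neg_mt : ∀ a b, neg (mt a b) = jt (neg a) (neg b)
  neg_jk : ∀ a b, neg (jk a b) = jk (neg a) (neg b)
  neg_mk : ∀ a b, neg (mk a b) = mk (neg a) (neg b)

/-- `a ∨_k b`, defined as `((a ∧_t b) ∧_t 0_k) ∨_t ((a ∨_t b) ∧_t 1_k)`. -/
def kJoin {A : Type u} (jt mt : A → A → A) (k0 k1 : A) (a b : A) : A :=
  jt (mt (mt a b) k0) (mt (jt a b) k1)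

/-- `a ∧_k b`, defined as `((a ∧_t b) ∧_t 1_k) ∨_t ((a ∨_t b) ∧_t 0_k)`. -/
def kMeet {A : Type u} (jt mt : A → A → A) (k0 k1 : A) (a b : A) : A :=
  jt (mt (mt a b) k1) (mt (jt a b) k0)

/-- (Bounded) distributive pre-bilattices, with the `k`-operations derived from the
`t`-operations and the constants. -/
structure IsDistribPreBilattice {A : Type u} (jt mt : A → A → A) (t0 t1 k0 k1 : A) : Prop
    extends IsUnboundedDistribPreBilattice jt mt (kJoin jt mt k0 k1) (kMeet jt mt k0 k1) where
  t_bot : ∀ a, jt t0 a = a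
  t_top : ∀ a, mt t1 a = a
  k_bot : ∀ a, kJoin jt mt k0 k1 k0 a = a
  k_top : ∀ a, kMeet jt mt k0 k1 k1 a = a

/-- Distributive bilattices: `neg` is involutory, a dual endomorphism of the bounded `t`-lattice
and an endomorphism of the bounded `k`-lattice. -/
structure IsDistribBilattice {A : Type u} (jt mt : A → A → A) (neg : A → A)
    (t0 t1 k0 k1 : A) : Prop extends IsDistribPreBilattice jt mt t0 t1 k0 k1 where
  neg_neg : ∀ a, neg (neg a) = a
  neg_jt : ∀ a b, neg (jt a b) = mt (neg a) (neg b)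
  neg_mt : ∀ a b, neg (mt a b) = jt (neg a) (neg b)
  neg_t0 : neg t0 = t1
  neg_t1 : neg t1 = t0
  neg_kJoin : ∀ a b,
    neg (kJoin jt mt k0 k1 a b) = kJoin jt mt k0 k1 (neg a) (neg b)
  neg_kMeet : ∀ a b,
    neg (kMeet jt mt k0 k1 a b) = kMeet jt mt k0 k1 (neg a) (neg b)
  neg_k0 : neg k0 = k0
  neg_k1 : neg k1 = k1

end Laws

section Languages

/-! ### The languages and the varieties `DB` and `DB_u` -/

/-- Operation symbols of distributive bilattices: `∨_t`, `∧_t`, `¬`, `0_t`, `1_t`, `0_k`, `1_k`. -/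
inductive DBFunc : ℕ → Type
  | jt : DBFunc 2
  | mt : DBFunc 2
  | neg : DBFunc 1
  | t0 : DBFunc 0
  | t1 : DBFunc 0
  | k0 : DBFunc 0
  | k1 : DBFunc 0

/-- The language of distributive bilattices. -/
abbrev dbLang : FirstOrder.Language.{0, 0} where
  Functions := DBFunc
  Relations := fun _ => Empty

instance : dbLang.IsAlgebraic := fun _ => inferInstanceAs (IsEmpty Empty)

/-- Operation symbols of unbounded distributive bilattices: `∨_t`, `∧_t`, `∨_k`, `∧_k`, `¬`. -/
inductive DBuFunc : ℕ → Type
  | jt : DBuFunc 2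
  | mt : DBuFunc 2
  | jk : DBuFunc 2
  | mk : DBuFunc 2
  | neg : DBuFunc 1

/-- The language of unbounded distributive bilattices. -/
abbrev dbuLang : FirstOrder.Language.{0, 0} where
  Functions := DBuFunc
  Relations := fun _ => Empty

instance : dbuLang.IsAlgebraic := fun _ => inferInstanceAs (IsEmpty Empty)

/-- The variety `DB` of distributive bilattices. -/
def DB : AlgClass.{u} dbLang := fun A _ =>
  let op {n : ℕ} (f : DBFunc n) (x : Fin n → A) : A := Structure.funMap (L := dbLang) f x
  IsDistribBilattice (fun a b => op .jt ![a, b]) (fun a b => op .mt ![a, b])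
    (fun a => op .neg ![a]) (op .t0 ![]) (op .t1 ![]) (op .k0 ![]) (op .k1 ![])

/-- The variety `DB_u` of unbounded distributive bilattices. -/
def DBu : AlgClass.{u} dbuLang := fun A _ =>
  let op {n : ℕ} (f : DBuFunc n) (x : Fin n → A) : A := Structure.funMap (L := dbuLang) f x
  IsUnboundedDistribBilattice (fun a b => op .jt ![a, b]) (fun a b => op .mt ![a, b])
    (fun a b => op .jk ![a, b]) (fun a b => op .mk ![a, b]) (fun a => op .neg ![a])

/-- The term `s ∨_t t`. -/
def tJoinTerm (s t : dbLang.Term ℕ) : dbLang.Term ℕ :=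
  Functions.apply₂ (L := dbLang) DBFunc.jt s t

/-- The term `s ∧_t t`. -/
def tMeetTerm (s t : dbLang.Term ℕ) : dbLang.Term ℕ :=
  Functions.apply₂ (L := dbLang) DBFunc.mt s t

/-- The constant `0_t` as a term. -/
def t0Term : dbLang.Term ℕ := Constants.term (L := dbLang) DBFunc.t0

/-- The constant `1_t` as a term. -/
def t1Term : dbLang.Term ℕ := Constants.term (L := dbLang) DBFunc.t1

/-- The constant `0_k` as a term. -/
def k0Term : dbLang.Term ℕ := Constants.term (L := dbLang) DBFunc.k0

/-- The constant `1_k` as a term. -/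
def k1Term : dbLang.Term ℕ := Constants.term (L := dbLang) DBFunc.k1

/-- The derived term `s ∨_k t`. -/
def kJoinTerm (s t : dbLang.Term ℕ) : dbLang.Term ℕ :=
  kJoin tJoinTerm tMeetTerm k0Term k1Term s t

/-- The derived term `s ∧_k t`. -/
def kMeetTerm (s t : dbLang.Term ℕ) : dbLang.Term ℕ :=
  kMeet tJoinTerm tMeetTerm k0Term k1Term s t

/-- The variable `x`. -/
def xVar : dbLang.Term ℕ := Term.var 0

/-- The variable `y`. -/
def yVar : dbLang.Term ℕ := Term.var 1

open Classical in
/-- The clause `({x ∧_k y ≈ 1_t}, {x ≈ 1_t, y ≈ 1_t})`. -/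
noncomputable def clauseMeet : Clause dbLang :=
  ({(kMeetTerm xVar yVar, t1Term)}, {(xVar, t1Term), (yVar, t1Term)})

open Classical in
/-- The clause `({x ∨_k y ≈ 1_t}, {x ≈ 1_t, y ≈ 1_t})`. -/
noncomputable def clauseJoin : Clause dbLang :=
  ({(kJoinTerm xVar yVar, t1Term)}, {(xVar, t1Term), (yVar, t1Term)})

/-- The clause `({0_t ≈ 1_t}, ∅)`. -/
def clauseNontrivial : Clause dbLang :=
  ({(t0Term, t1Term)}, ∅)

end Languages

end Bilat

/-! Everything reduces to the four-element bilattice `Four`: homomorphisms into it separate the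
points of every algebra in either variety (`dbu_exists_hom_separating`, `db_exists_hom_separating`).
Hence two terms agree in the free algebra exactly when they define the same function on `Four`, and
admissibility of a clause becomes a statement about substitutions of terms evaluated in `Four`
(`FourGenerates.admissible_iff`).

For a quasi-equation over `DB`, one homomorphism refutes the conclusion. Each element of `Four` is
named by a constant, so the homomorphism itself becomes a substitution by constants that refutes
admissibility.

With several conclusions, a refuting assignment `v` yields finitely many homomorphisms `h p`, all of
which must be encoded in one substitution. Every evaluation of that substitution has to be some
homomorphism composed with `v`, so that the premises survive (`FourGenerates.holds_of_admissible`).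
The terms of `ClosedUnderOps.exists_selector` return the values of `h p` when exactly one switch `p`
is on, and otherwise `⊥` or `⊤`. These two extra outcomes must also come from homomorphisms. Over
`DBu` the constant maps to `⊥` and `⊤` are homomorphisms. Over `DB` the outcomes are clipped between
a `k`-least and a `k`-greatest homomorphism, which the three clauses provide (`exists_least_hom`,
`exists_greatest_hom`). Conversely, the clauses are admissible because terms are `k`-monotone on
`Four`. -/

namespace Bilat

/-! ### Separation of points by Boolean-valued maps -/

section Separation

variable {A : Type u}

theorem IsLatticeOps.join_self {j m : A → A → A} (h : IsLatticeOps j m) (a : A) : j a a = a := by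
  simpa only [h.meet_join] using h.join_meet a (j a a)

/-- Distinct elements of a distributive lattice are separated by a homomorphism to `Bool`. -/
theorem exists_lattice_hom_separating {j m : A → A → A} (h : IsLatticeOps j m)
    (hd : DistribOver j m) {a b : A} (hab : a ≠ b) :
    ∃ f : A → Bool, (∀ x y, f (j x y) = (f x || f y)) ∧ (∀ x y, f (m x y) = (f x && f y)) ∧
      f a ≠ f b := by
  classical
  let : Max A := ⟨j⟩
  let : Min A := ⟨m⟩
  let : Lattice A := Lattice.mk' h.join_comm h.join_assoc h.meet_comm h.meet_assoc
    h.join_meet h.meet_join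
  let : DistribLattice A := ⟨fun x y z => (hd x y z).ge⟩
  have key : ∀ a b : A, ¬ a ≤ b → ∃ f : A → Bool, (∀ x y, f (j x y) = (f x || f y)) ∧
      (∀ x y, f (m x y) = (f x && f y)) ∧ f a ≠ f b := by
    intro a b hab
    obtain ⟨J, hJ, hIJ, hFJ⟩ := DistribLattice.prime_ideal_of_disjoint_filter_ideal
      (F := Order.PFilter.principal a) (I := Order.Ideal.principal b)
      (Set.disjoint_left.2 fun x hx hx' => hab (le_trans hx hx'))
    refine ⟨fun x => decide (x ∉ J), fun x y => ?_, fun x y => ?_, ?_⟩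
    · have : j x y ∈ J ↔ x ∈ J ∧ y ∈ J := Order.Ideal.sup_mem_iff
      by_cases hx : x ∈ J <;> by_cases hy : y ∈ J <;> simp [this, hx, hy]
    · have : m x y ∈ J ↔ x ∈ J ∨ y ∈ J :=
        ⟨hJ.mem_or_mem, fun h => h.elim (J.lower inf_le_left) (J.lower inf_le_right)⟩
      by_cases hx : x ∈ J <;> by_cases hy : y ∈ J <;> simp [this, hx, hy]
    · have ha : a ∉ J := Set.disjoint_left.1 hFJ (le_refl a)
      have hb : b ∈ J := hIJ (le_refl b)
      simp [ha, hb]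
  by_cases hle : a ≤ b
  · obtain ⟨f, h1, h2, h3⟩ := key b a fun h' => hab (le_antisymm hle h')
    exact ⟨f, h1, h2, h3.symm⟩
  · exact key a b hle

/-- A lattice homomorphism to `Bool` turns any commutative idempotent operation over which both
lattice operations distribute into conjunction or disjunction. -/
theorem hom_op_eq_and_or {j m g : A → A → A} (h : IsLatticeOps j m)
    (hjg : DistribOver j g) (hmg : DistribOver m g)
    (hgc : ∀ a b, g a b = g b a) (hgi : ∀ a, g a a = a)
    {f : A → Bool} (hj : ∀ x y, f (j x y) = (f x || f y)) (hm : ∀ x y, f (m x y) = (f x && f y)) :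
    (∀ x y, f (g x y) = (f x && f y)) ∨ (∀ x y, f (g x y) = (f x || f y)) := by
  have hmi : ∀ a, m a a = a := fun a =>
    IsLatticeOps.join_self (j := m) (m := j)
      ⟨h.meet_comm, h.join_comm, h.meet_assoc, h.join_assoc, h.meet_join, h.join_meet⟩ a
  have hji := h.join_self
  have congr_left : ∀ x x' y, f x = f x' → f (g x y) = f (g x' y) := by
    intro x x' y hx
    cases hfx : f x
    · have h1 : j (j x x') (g x y) = j (j x x') (g x' y) := by
        rw [hjg, hjg]; congr 1
        rw [h.join_assoc x x' x', hji, h.join_comm x x', h.join_assoc, hji]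
      have := congrArg f h1
      simpa [hj, ← hx, hfx] using this
    · have h1 : m (m x x') (g x y) = m (m x x') (g x' y) := by
        rw [hmg, hmg]; congr 1
        rw [h.meet_assoc x x' x', hmi, h.meet_comm x x', h.meet_assoc, hmi]
      have := congrArg f h1
      simpa [hm, ← hx, hfx] using this
  have congr₂ : ∀ x x' y y', f x = f x' → f y = f y' → f (g x y) = f (g x' y') := by
    intro x x' y y' hx hy
    rw [congr_left x x' y hx, hgc, congr_left y y' x' hy, hgc]
  have same : ∀ x y, f x = f y → f (g x y) = f x := fun x y hxy => by
    rw [congr₂ x x y x rfl hxy.symm, hgi]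
  by_cases hex : ∃ x y, f x = true ∧ f y = false ∧ f (g x y) = true
  · obtain ⟨x, y, hx, hy, hxy⟩ := hex
    right
    intro a b
    cases ha : f a <;> cases hb : f b
    · rw [same _ _ (ha.trans hb.symm), ha]; rfl
    · rw [hgc, congr₂ b x a y (hb.trans hx.symm) (ha.trans hy.symm), hxy]; rfl
    · rw [congr₂ a x b y (ha.trans hx.symm) (hb.trans hy.symm), hxy]; rfl
    · rw [same _ _ (ha.trans hb.symm), ha]; rfl
  · left
    intro a b
    cases ha : f a <;> cases hb : f b
    · rw [same _ _ (ha.trans hb.symm), ha]; rfl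
    · rw [hgc]; exact Bool.eq_false_iff.2 fun hg => hex ⟨b, a, hb, ha, hg⟩
    · exact Bool.eq_false_iff.2 fun hg => hex ⟨a, b, ha, hb, hg⟩
    · rw [same _ _ (ha.trans hb.symm), ha]; rfl

/-- A map to `Bool` that is a homomorphism for both lattice reducts. -/
structure IsBihom (jt mt jk mk : A → A → A) (f : A → Bool) : Prop where
  map_jt : ∀ x y, f (jt x y) = (f x || f y)
  map_mt : ∀ x y, f (mt x y) = (f x && f y)
  map_jk : ∀ x y, f (jk x y) = (f x || f y)
  map_mk : ∀ x y, f (mk x y) = (f x && f y)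

/-- A prime ideal of the `t`-lattice gives `f`, which may reverse the `k`-lattice. Negation repairs
this, since it reverses only the `t`-order; the price is that separation may be seen only after
applying `neg`. -/
theorem exists_bihom_separating {jt mt jk mk : A → A → A} {neg : A → A}
    (h : IsUnboundedDistribBilattice jt mt jk mk neg) {a b : A} (hab : a ≠ b) :
    ∃ f : A → Bool, IsBihom jt mt jk mk f ∧ (f a ≠ f b ∨ f (neg a) ≠ f (neg b)) := by
  obtain ⟨f, hj, hm, hf⟩ := exists_lattice_hom_separating h.t_lattice h.jt_mt hab
  have hk := h.k_lattice
  have hk' : IsLatticeOps mk jk :=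
    ⟨hk.meet_comm, hk.join_comm, hk.meet_assoc, hk.join_assoc, hk.meet_join, hk.join_meet⟩
  have hsurj : ∃ x y, f x = true ∧ f y = false := by
    cases ha : f a <;> cases hb : f b
    · simp [ha, hb] at hf
    · exact ⟨b, a, hb, ha⟩
    · exact ⟨a, b, ha, hb⟩
    · simp [ha, hb] at hf
  obtain ⟨x, y, hx, hy⟩ := hsurj
  rcases hom_op_eq_and_or h.t_lattice h.jt_jk h.mt_jk hk.join_comm hk.join_self hj hm with h1 | h1 <;>
  rcases hom_op_eq_and_or h.t_lattice h.jt_mk h.mt_mk hk.meet_comm hk'.join_self hj hm with h2 | h2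
  -- Both `k`-operations acting as conjunction would violate absorption.
  · have := congrArg f (hk.join_meet x y)
    simp [h1, h2, hx, hy] at this
  -- Complementing turns the `k`-order round; composing with `neg` undoes the effect of
  -- complementing on the `t`-order.
  · refine ⟨fun x => !f (neg x), ⟨?_, ?_, ?_, ?_⟩, Or.inr ?_⟩
    · intro x y; simp [h.neg_jt, hm]
    · intro x y; simp [h.neg_mt, hj]
    · intro x y; simp [h.neg_jk, h1]
    · intro x y; simp [h.neg_mk, h2]
    · simpa [h.neg_neg] using hf
  · exact ⟨f, ⟨hj, hm, h1, h2⟩, Or.inl hf⟩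
  · have := congrArg f (hk.meet_join y x)
    simp [h1, h2, hx, hy] at this

end Separation

/-! ### The four-element bilattice -/

section Four

/-- The four-element bilattice; the product order is the `k`-order. -/
abbrev Four : Type := Bool × Bool

namespace Four

def jt (a b : Four) : Four := (a.1 || b.1, a.2 && b.2)
def mt (a b : Four) : Four := (a.1 && b.1, a.2 || b.2)
def neg (a : Four) : Four := (a.2, a.1)

theorem isUnboundedDistribBilattice :
    IsUnboundedDistribBilattice jt mt (· ⊔ ·) (· ⊓ ·) neg := by
  refine ⟨⟨⟨?_, ?_, ?_, ?_, ?_, ?_⟩, ⟨?_, ?_, ?_, ?_, ?_, ?_⟩, ?_, ?_, ?_, ?_, ?_, ?_, ?_, ?_, ?_,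
    ?_, ?_, ?_⟩, ?_, ?_, ?_, ?_, ?_⟩ <;> (try unfold DistribOver) <;> decide

theorem kJoin_eq (a b : Four) : kJoin jt mt ⊥ ⊤ a b = a ⊔ b := by
  revert a b; unfold kJoin; decide

theorem kMeet_eq (a b : Four) : kMeet jt mt ⊥ ⊤ a b = a ⊓ b := by
  revert a b; unfold kMeet; decide

theorem isDistribBilattice :
    IsDistribBilattice jt mt neg (false, true) (true, false) ⊥ ⊤ := by
  have hj : kJoin jt mt ⊥ ⊤ = (· ⊔ ·) := funext₂ kJoin_eq
  have hm : kMeet jt mt ⊥ ⊤ = (· ⊓ ·) := funext₂ kMeet_eq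
  have h := isUnboundedDistribBilattice
  refine ⟨⟨?_, ?_, ?_, ?_, ?_⟩, h.neg_neg, h.neg_jt, h.neg_mt, rfl, rfl, ?_, ?_, rfl, rfl⟩
  · rw [hj, hm]; exact h.toIsUnboundedDistribPreBilattice
  · decide
  · decide
  · rw [hj]; decide
  · rw [hm]; decide
  · rw [hj]; exact h.neg_jk
  · rw [hm]; exact h.neg_mk

end Four

/-- The standard interpretation of the bilattice operations on `Four`. -/
instance Four.dbStructure : dbLang.Structure Four where
  funMap
    | .jt, x => Four.jt (x 0) (x 1)
    | .mt, x => Four.mt (x 0) (x 1)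
    | .neg, x => Four.neg (x 0)
    | .t0, _ => (false, true)
    | .t1, _ => (true, false)
    | .k0, _ => ⊥
    | .k1, _ => ⊤
  RelMap r _ := isEmptyElim r

instance Four.dbuStructure : dbuLang.Structure Four where
  funMap
    | .jt, x => Four.jt (x 0) (x 1)
    | .mt, x => Four.mt (x 0) (x 1)
    | .jk, x => x 0 ⊔ x 1
    | .mk, x => x 0 ⊓ x 1
    | .neg, x => Four.neg (x 0)
  RelMap r _ := isEmptyElim r

end Four

/-! ### Transport of the four-element bilattice to any universe -/

section Complete

/-- The structure on `ULift M` that makes `ULift.down` an isomorphism. -/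
abbrev uliftStructure (L : FirstOrder.Language.{0, 0}) (M : Type) [L.Structure M] :
    L.Structure (ULift.{u} M) where
  funMap f x := ⟨Structure.funMap f fun i => (x i).down⟩
  RelMap r x := Structure.RelMap r fun i => (x i).down

theorem realize_ulift {L : FirstOrder.Language.{0, 0}} {M : Type} [L.Structure M]
    (t : L.Term ℕ) (v : ℕ → M) :
    letI := uliftStructure.{u} L M
    t.realize (fun i => (⟨v i⟩ : ULift.{u} M)) = ⟨t.realize v⟩ := by
  let := uliftStructure.{u} L M
  induction t with
  | var => rfl
  | func f ts ih => simp only [Term.realize, ih]; rfl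

theorem IsUnboundedDistribBilattice.ulift {A : Type} {jt mt jk mk : A → A → A} {neg : A → A}
    (h : IsUnboundedDistribBilattice jt mt jk mk neg) :
    IsUnboundedDistribBilattice (A := ULift.{u} A) (fun a b => ⟨jt a.down b.down⟩)
      (fun a b => ⟨mt a.down b.down⟩) (fun a b => ⟨jk a.down b.down⟩)
      (fun a b => ⟨mk a.down b.down⟩) (fun a => ⟨neg a.down⟩) := by
  obtain ⟨⟨⟨t1, t2, t3, t4, t5, t6⟩, ⟨k1, k2, k3, k4, k5, k6⟩, d1, d2, d3, d4, d5, d6, d7, d8, d9,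
    d10, d11, d12⟩, n1, n2, n3, n4, n5⟩ := h
  unfold DistribOver at *
  constructor
  · constructor <;> try constructor
    all_goals first
      | (intro a b c; apply ULift.down_injective; solve_by_elim)
      | (intro a b; apply ULift.down_injective; solve_by_elim)
  all_goals first
    | (intro a b; apply ULift.down_injective; solve_by_elim)
    | (intro a; apply ULift.down_injective; solve_by_elim)

theorem dbuULiftFour : @DBu (ULift.{u} Four) (uliftStructure dbuLang Four) :=
  Four.isUnboundedDistribBilattice.ulift

theorem IsDistribBilattice.isUnboundedDistribBilattice {A : Type u} {jt mt : A → A → A}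
    {neg : A → A} {t0 t1 k0 k1 : A} (h : IsDistribBilattice jt mt neg t0 t1 k0 k1) :
    IsUnboundedDistribBilattice jt mt (kJoin jt mt k0 k1) (kMeet jt mt k0 k1) neg :=
  ⟨h.toIsUnboundedDistribPreBilattice, h.neg_neg, h.neg_jt, h.neg_mt, h.neg_kJoin, h.neg_kMeet⟩

theorem IsDistribBilattice.ulift {A : Type} {jt mt : A → A → A} {neg : A → A} {t0 t1 k0 k1 : A}
    (h : IsDistribBilattice jt mt neg t0 t1 k0 k1) :
    IsDistribBilattice (A := ULift.{u} A) (fun a b => ⟨jt a.down b.down⟩)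
      (fun a b => ⟨mt a.down b.down⟩) (fun a => ⟨neg a.down⟩) ⟨t0⟩ ⟨t1⟩ ⟨k0⟩ ⟨k1⟩ := by
  have hl := h.isUnboundedDistribBilattice.ulift.{u}
  exact ⟨⟨hl.toIsUnboundedDistribPreBilattice, fun a => congrArg ULift.up (h.t_bot a.down),
    fun a => congrArg ULift.up (h.t_top a.down), fun a => congrArg ULift.up (h.k_bot a.down),
    fun a => congrArg ULift.up (h.k_top a.down)⟩, hl.neg_neg, hl.neg_jt, hl.neg_mt,
    congrArg ULift.up h.neg_t0, congrArg ULift.up h.neg_t1, hl.neg_jk, hl.neg_mk,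
    congrArg ULift.up h.neg_k0, congrArg ULift.up h.neg_k1⟩

theorem dbULiftFour : @DB (ULift.{u} Four) (uliftStructure dbLang Four) :=
  Four.isDistribBilattice.ulift

end Complete

/-! ### Homomorphisms to the four-element bilattice -/

section Homs

variable {A : Type u}

/-- The homomorphism to `Four` whose first coordinate is `f`. -/
def dbuHom [dbuLang.Structure A] (hA : DBu A) (f : A → Bool)
    (hf : IsBihom (A := A) (fun a b => Structure.funMap (L := dbuLang) DBuFunc.jt ![a, b])
      (fun a b => Structure.funMap (L := dbuLang) DBuFunc.mt ![a, b])
      (fun a b => Structure.funMap (L := dbuLang) DBuFunc.jk ![a, b])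
      (fun a b => Structure.funMap (L := dbuLang) DBuFunc.mk ![a, b]) f) :
    A →[dbuLang] Four where
  toFun a := (f a, f (Structure.funMap (L := dbuLang) DBuFunc.neg ![a]))
  map_fun' {n} g x := by
    have h2 : ∀ x : Fin 2 → A, x = ![x 0, x 1] := fun x => by ext i; fin_cases i <;> rfl
    have h1 : ∀ x : Fin 1 → A, x = ![x 0] := fun x => by ext i; fin_cases i; rfl
    cases g
    · rw [h2 x]
      exact Prod.ext (hf.map_jt _ _) ((congrArg f (hA.neg_jt _ _)).trans (hf.map_mt _ _))
    · rw [h2 x]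
      exact Prod.ext (hf.map_mt _ _) ((congrArg f (hA.neg_mt _ _)).trans (hf.map_jt _ _))
    · rw [h2 x]
      exact Prod.ext (hf.map_jk _ _) ((congrArg f (hA.neg_jk _ _)).trans (hf.map_jk _ _))
    · rw [h2 x]
      exact Prod.ext (hf.map_mk _ _) ((congrArg f (hA.neg_mk _ _)).trans (hf.map_mk _ _))
    · rw [h1 x]
      exact Prod.ext rfl (congrArg f (hA.neg_neg _))
  map_rel' r := isEmptyElim r

theorem dbu_exists_hom_separating [dbuLang.Structure A] (hA : DBu A) {a b : A} (hab : a ≠ b) :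
    ∃ h : A →[dbuLang] Four, h a ≠ h b := by
  obtain ⟨f, hf, hne⟩ := exists_bihom_separating hA hab
  refine ⟨dbuHom hA f hf, fun h => ?_⟩
  have := Prod.ext_iff.1 h
  exact hne.elim (fun h => h this.1) (fun h => h this.2)

/-- The homomorphism to `Four` whose first coordinate is `f`. -/
def dbHom [dbLang.Structure A] (hA : DB A) (f : A → Bool)
    (hj : ∀ a b, f (Structure.funMap (L := dbLang) DBFunc.jt ![a, b]) = (f a || f b))
    (hm : ∀ a b, f (Structure.funMap (L := dbLang) DBFunc.mt ![a, b]) = (f a && f b))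
    (ht0 : f (Structure.funMap (L := dbLang) DBFunc.t0 ![]) = false)
    (ht1 : f (Structure.funMap (L := dbLang) DBFunc.t1 ![]) = true)
    (hk0 : f (Structure.funMap (L := dbLang) DBFunc.k0 ![]) = false)
    (hk1 : f (Structure.funMap (L := dbLang) DBFunc.k1 ![]) = true) :
    A →[dbLang] Four where
  toFun a := (f a, f (Structure.funMap (L := dbLang) DBFunc.neg ![a]))
  map_fun' {n} g x := by
    have h2 : ∀ x : Fin 2 → A, x = ![x 0, x 1] := fun x => by ext i; fin_cases i <;> rfl
    have h1 : ∀ x : Fin 1 → A, x = ![x 0] := fun x => by ext i; fin_cases i; rfl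
    have h0 : ∀ x : Fin 0 → A, x = ![] := fun x => Subsingleton.elim _ _
    cases g
    · rw [h2 x]
      exact Prod.ext (hj _ _) ((congrArg f (hA.neg_jt _ _)).trans (hm _ _))
    · rw [h2 x]
      exact Prod.ext (hm _ _) ((congrArg f (hA.neg_mt _ _)).trans (hj _ _))
    · rw [h1 x]
      exact Prod.ext rfl (congrArg f (hA.neg_neg _))
    · rw [h0 x]
      exact Prod.ext ht0 ((congrArg f hA.neg_t0).trans ht1)
    · rw [h0 x]
      exact Prod.ext ht1 ((congrArg f hA.neg_t1).trans ht0)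
    · rw [h0 x]
      exact Prod.ext hk0 ((congrArg f hA.neg_k0).trans hk0)
    · rw [h0 x]
      exact Prod.ext hk1 ((congrArg f hA.neg_k1).trans hk1)
  map_rel' r := isEmptyElim r

theorem db_exists_hom_separating [dbLang.Structure A] (hA : DB A) {a b : A} (hab : a ≠ b) :
    ∃ h : A →[dbLang] Four, h a ≠ h b := by
  obtain ⟨f, hf, hne⟩ := exists_bihom_separating hA.isUnboundedDistribBilattice hab
  -- The map `f` is not constant, because it separates a pair. Taking both values forces the right
  -- values at the four bounds.
  have hfalse : ∃ x, f x = false := by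
    by_contra! h
    simp only [ne_eq, Bool.not_eq_false] at h
    simp [h] at hne
  have htrue : ∃ x, f x = true := by
    by_contra! h
    simp only [ne_eq, Bool.not_eq_true] at h
    simp [h] at hne
  obtain ⟨x, hx⟩ := hfalse
  obtain ⟨y, hy⟩ := htrue
  have ht0 := (hf.map_jt _ _).symm.trans (congrArg f (hA.t_bot x))
  have ht1 := (hf.map_mt _ _).symm.trans (congrArg f (hA.t_top y))
  have hk0 := (hf.map_jk _ _).symm.trans (congrArg f (hA.k_bot x))
  have hk1 := (hf.map_mk _ _).symm.trans (congrArg f (hA.k_top y))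
  rw [hx, Bool.or_eq_false_iff] at ht0 hk0
  rw [hy, Bool.and_eq_true] at ht1 hk1
  refine ⟨dbHom hA f hf.map_jt hf.map_mt ht0.1 ht1.1 hk0.1 hk1.1, fun h => ?_⟩
  have := Prod.ext_iff.1 h
  exact hne.elim (fun h => h this.1) (fun h => h this.2)

end Homs

/-! ### The free algebra and admissibility in terms of `Four` -/

section Free

variable {L : FirstOrder.Language.{0, 0}}

/-- The identities valid in `K` are those valid in `Four`. -/
def FourGenerates [L.Structure Four] (K : AlgClass.{u} L) : Prop :=
  ∀ s t : L.Term ℕ, identitySetoid K s t ↔ ∀ ω : ℕ → Four, s.realize ω = t.realize ω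

theorem FourGenerates.of_separating [L.Structure Four] {K : AlgClass.{u} L}
    (hF : @K (ULift.{u} Four) (uliftStructure L Four))
    (hsep : ∀ (A : Type u) [L.Structure A], K A → ∀ a b : A, a ≠ b →
      ∃ h : A →[L] Four, h a ≠ h b) : FourGenerates K := by
  refine fun s t => ⟨fun h ω => ?_, fun h A _ hA v => ?_⟩
  · have := @h (ULift.{u} Four) (uliftStructure L Four) hF fun i => ⟨ω i⟩
    rw [realize_ulift, realize_ulift] at this
    exact congrArg ULift.down this
  · by_contra hne
    obtain ⟨g, hg⟩ := hsep A hA _ _ hne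
    exact hg (by rw [← HomClass.realize_term, ← HomClass.realize_term, h])

theorem dbu_fourGenerates : FourGenerates DBu.{u} :=
  .of_separating dbuULiftFour fun _ _ hA _ _ => dbu_exists_hom_separating hA

theorem db_fourGenerates : FourGenerates DB.{u} :=
  .of_separating dbULiftFour fun _ _ hA _ _ => db_exists_hom_separating hA

theorem realize_freeAlg [L.IsAlgebraic] (K : AlgClass.{u} L) (s : L.Term ℕ) (τ : ℕ → L.Term ℕ) :
    s.realize (fun i => (⟦τ i⟧ : FreeAlg K)) = ⟦s.subst τ⟧ := by
  rw [Term.realize_quotient_mk']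
  congr 1
  induction s with
  | var => rfl
  | func f ts ih => exact congrArg (Term.func f) (funext ih)

/-- Assignments in the free algebra are substitutions `τ` of terms, and equality of classes is
equality of term functions on `Four`. -/
theorem FourGenerates.admissible_iff [L.IsAlgebraic] [L.Structure Four] {K : AlgClass.{u} L}
    (hK : FourGenerates K) (c : Clause L) :
    c.Admissible K ↔ ∀ τ : ℕ → L.Term ℕ,
      (∀ e ∈ c.1, ∀ ω : ℕ → Four, e.1.realize (fun i => (τ i).realize ω) =
        e.2.realize fun i => (τ i).realize ω) →
      ∃ e ∈ c.2, ∀ ω : ℕ → Four, e.1.realize (fun i => (τ i).realize ω) =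
        e.2.realize fun i => (τ i).realize ω := by
  have key : ∀ (s t : L.Term ℕ) (τ : ℕ → L.Term ℕ),
      s.realize (fun i => (⟦τ i⟧ : FreeAlg K)) = t.realize (fun i => (⟦τ i⟧ : FreeAlg K)) ↔
        ∀ ω : ℕ → Four, s.realize (fun i => (τ i).realize ω) =
          t.realize fun i => (τ i).realize ω := by
    intro s t τ
    rw [realize_freeAlg, realize_freeAlg, Quotient.eq, hK]
    simp only [Term.realize_subst]
  have hsurj : ∀ v : ℕ → FreeAlg K, ∃ τ : ℕ → L.Term ℕ, v = fun i => ⟦τ i⟧ := fun v =>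
    ⟨fun i => (v i).out, funext fun i => (Quotient.out_eq _).symm⟩
  constructor
  · intro h τ hτ
    obtain ⟨e, he, h'⟩ := h (fun i => ⟦τ i⟧) fun e he => (key _ _ _).2 (hτ e he)
    exact ⟨e, he, (key _ _ _).1 h'⟩
  · intro h v hv
    obtain ⟨τ, rfl⟩ := hsurj v
    obtain ⟨e, he, h'⟩ := h τ fun e he => (key _ _ _).1 (hv e he)
    exact ⟨e, he, (key _ _ _).2 h'⟩

/-- An algebra whose homomorphisms to `Four` separate points satisfies an admissible clause if
any finite family of these homomorphisms is, on any assignment, captured by terms all of whose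
evaluations in `Four` come from homomorphisms. -/
theorem FourGenerates.holds_of_admissible [L.IsAlgebraic] [L.Structure Four] {K : AlgClass.{u} L}
    (hK : FourGenerates K) {A : Type u} [L.Structure A]
    (hsep : ∀ a b : A, a ≠ b → ∃ h : A →[L] Four, h a ≠ h b)
    (hterm : ∀ (ι : Type) [Finite ι] (h : ι → (A →[L] Four)) (v : ℕ → A),
      ∃ τ : ℕ → L.Term ℕ,
        (∀ ω : ℕ → Four, ∃ g : A →[L] Four, ∀ i, (τ i).realize ω = g (v i)) ∧
        ∀ p, ∃ ω : ℕ → Four, ∀ i, (τ i).realize ω = h p (v i))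
    {c : Clause L} (hc : c.Admissible K) : c.Holds A := by
  intro v hv
  by_contra! hne
  choose h hh using fun e : {e // e ∈ c.2} => hsep _ _ (hne e.1 e.2)
  obtain ⟨τ, hτ, hτ'⟩ := hterm _ h v
  -- The premises hold under `τ` because each evaluation factors through `v` by a homomorphism.
  obtain ⟨e, he, heq⟩ := (hK.admissible_iff c).1 hc τ fun e he ω => by
    obtain ⟨g, hg⟩ := hτ ω
    have : (fun i => (τ i).realize ω) = g ∘ v := funext hg
    rw [this, HomClass.realize_term, HomClass.realize_term, hv e he]
  obtain ⟨ω, hω⟩ := hτ' ⟨e, he⟩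
  have h1 := heq ω
  have : (fun i => (τ i).realize ω) = h ⟨e, he⟩ ∘ v := funext hω
  rw [this, HomClass.realize_term, HomClass.realize_term] at h1
  exact hh ⟨e, he⟩ h1

end Free

/-! ### Admissible quasi-equations of `DB` -/

section Quasi

theorem exists_constant_term (a : Four) :
    ∃ t : dbLang.Term ℕ, ∀ ω : ℕ → Four, t.realize ω = a := by
  obtain ⟨_ | _, _ | _⟩ := a
  exacts [⟨k0Term, fun _ => rfl⟩, ⟨t0Term, fun _ => rfl⟩, ⟨t1Term, fun _ => rfl⟩,
    ⟨k1Term, fun _ => rfl⟩]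

theorem valid_of_admissible_of_isQuasiIdentity {c : Clause dbLang} (hq : c.IsQuasiIdentity)
    (hc : c.Admissible DB.{u}) : c.Valid DB.{u} := by
  intro A _ _ hA v hv
  obtain ⟨e, he⟩ := Finset.card_eq_one.1 hq
  refine ⟨e, by simp [he], ?_⟩
  by_contra hne
  obtain ⟨h, hh⟩ := db_exists_hom_separating hA hne
  choose τ hτ using fun i => exists_constant_term (h (v i))
  have hτ' : ∀ ω : ℕ → Four, (fun i => (τ i).realize ω) = h ∘ v := fun ω => funext fun i => hτ i ω
  obtain ⟨e', he', heq⟩ := (db_fourGenerates.admissible_iff c).1 hc τ fun e he ω => by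
    rw [hτ', HomClass.realize_term, HomClass.realize_term, hv e he]
  rw [he, Finset.mem_singleton] at he'
  subst he'
  -- Any assignment would do, as the substituted terms are constant.
  have := heq fun _ => ⊥
  rw [hτ', HomClass.realize_term, HomClass.realize_term] at this
  exact hh this

end Quasi

/-! ### Term functions on `Four` and selector terms -/

section Clones

/-- A set of `Four`-valued functions closed under the pointwise bilattice operations. -/
structure ClosedUnderOps {Ω : Type} (T : Set (Ω → Four)) : Prop where
  sup : ∀ f ∈ T, ∀ g ∈ T, f ⊔ g ∈ T
  inf : ∀ f ∈ T, ∀ g ∈ T, f ⊓ g ∈ T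
  jt : ∀ f ∈ T, ∀ g ∈ T, (fun ω => Four.jt (f ω) (g ω)) ∈ T
  mt : ∀ f ∈ T, ∀ g ∈ T, (fun ω => Four.mt (f ω) (g ω)) ∈ T
  neg : ∀ f ∈ T, (fun ω => Four.neg (f ω)) ∈ T

/-- The element `k` keeps the supremum in `T` when `s` is empty, as `⊥` need not belong to `T`. -/
theorem sup_finset_sup_mem {α ι : Type} [Lattice α] [BoundedOrder α] {T : Set α}
    (hT : ∀ f ∈ T, ∀ g ∈ T, f ⊔ g ∈ T) {k : α} (hk : k ∈ T) (s : Finset ι) (f : ι → α)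
    (hf : ∀ i ∈ s, f i ∈ T) : k ⊔ s.sup f ∈ T := by
  classical
  induction s using Finset.induction_on with
  | empty => simpa using hk
  | insert a s ha ih =>
    rw [Finset.sup_insert, sup_left_comm]
    exact hT _ (hf _ (by simp)) _ (ih fun i hi => hf i (by simp [hi]))

theorem inf_finset_inf_mem {α ι : Type} [Lattice α] [BoundedOrder α] {T : Set α}
    (hT : ∀ f ∈ T, ∀ g ∈ T, f ⊓ g ∈ T) {k : α} (hk : k ∈ T) (s : Finset ι) (f : ι → α)
    (hf : ∀ i ∈ s, f i ∈ T) : k ⊓ s.inf f ∈ T :=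
  sup_finset_sup_mem (α := αᵒᵈ) hT hk s f hf

theorem Four.inf_neg (a : Four) : a ⊓ Four.neg a = if a = ⊤ then ⊤ else ⊥ := by
  revert a; decide

/-- From local `k`-bounds and finitely many functions `x p`, a closed set of functions contains one
that takes the value `w p` where exactly `x p` equals `⊤`, the value `⊥` where no `x p` does, and
the value `⊤` where more than one does. -/
theorem ClosedUnderOps.exists_selector {Ω : Type} {T : Set (Ω → Four)} (hT : ClosedUnderOps T)
    {ι : Type} [Fintype ι] {x : ι → Ω → Four} (hx : ∀ p, x p ∈ T) {K0 K1 : Ω → Four}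
    (hK0 : K0 ∈ T) (hK1 : K1 ∈ T) (w : ι → Four) :
    ∃ t ∈ T, ∀ ω, K0 ω = ⊥ → K1 ω = ⊤ →
      ((∀ p, x p ω ≠ ⊤) → t ω = ⊥) ∧
      (∀ p, (∀ q, x q ω = ⊤ ↔ q = p) → t ω = w p) ∧
      (∀ p q, p ≠ q → x p ω = ⊤ → x q ω = ⊤ → t ω = ⊤) := by
  classical
  -- Where `K0` and `K1` act as the `k`-bounds, their `t`-meet and `t`-join act as the `t`-bounds,
  -- so all of `Four` is available.
  have hW : ∀ a : Four, ∃ W ∈ T, ∀ ω, K0 ω = ⊥ → K1 ω = ⊤ → W ω = a := by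
    rintro ⟨_ | _, _ | _⟩
    · exact ⟨K0, hK0, fun ω h0 h1 => h0⟩
    · exact ⟨_, hT.mt _ hK0 _ hK1, fun ω h0 h1 => by simp only [h0, h1]; rfl⟩
    · exact ⟨_, hT.jt _ hK0 _ hK1, fun ω h0 h1 => by simp only [h0, h1]; rfl⟩
    · exact ⟨K1, hK1, fun ω h0 h1 => h1⟩
  choose W hWT hW using hW
  -- A two-valued test for `x p = ⊤`.
  let d : ι → Ω → Four := fun p => x p ⊓ fun ω => Four.neg (x p ω)
  have hd : ∀ p, d p ∈ T := fun p => hT.inf _ (hx p) _ (hT.neg _ (hx p))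
  have hdv : ∀ p ω, d p ω = if x p ω = ⊤ then ⊤ else ⊥ := fun p ω => Four.inf_neg _
  -- The first supremum releases `w p` for each switch that is on; the second raises the value to
  -- `⊤` as soon as two distinct switches are on.
  refine ⟨_, sup_finset_sup_mem hT.sup
    (sup_finset_sup_mem hT.sup hK0 Finset.univ (fun p => d p ⊓ W (w p))
      fun p _ => hT.inf _ (hd p) _ (hWT _))
    (Finset.univ.filter fun pq : ι × ι => pq.1 ≠ pq.2) (fun pq => d pq.1 ⊓ d pq.2)
      fun pq _ => hT.inf _ (hd _) _ (hd _), fun ω h0 h1 => ?_⟩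
  simp only [Pi.sup_apply, Finset.sup_apply, Pi.inf_apply, hdv, hW _ ω h0 h1, h0, bot_sup_eq]
  refine ⟨fun h => ?_, fun p h => ?_, fun p q hpq hp hq => ?_⟩
  · simp [h]
  · simp only [h]
    apply le_antisymm
    · refine sup_le (Finset.sup_le fun q _ => ?_) (Finset.sup_le fun q hq => ?_)
      · by_cases hqp : q = p <;> simp [hqp]
      · have hne := (Finset.mem_filter.1 hq).2
        by_cases hqp : q.1 = p
        · have : q.2 ≠ p := fun h => hne (hqp.trans h.symm)
          simp [this]
        · simp [hqp]
    · refine le_sup_of_le_left ?_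
      refine le_trans ?_ (Finset.le_sup (Finset.mem_univ p))
      simp
  · refine top_le_iff.1 (le_sup_of_le_right ?_)
    refine le_trans ?_ (Finset.le_sup (b := (p, q)) (by simpa using hpq))
    simp [hp, hq]

theorem exists_assignment {ι : Type} {enc : ι → ℕ} (henc : Function.Injective enc)
    (a : ι → Four) : ∃ ω : ℕ → Four, ∀ p, ω (enc p) = a p :=
  ⟨Function.extend enc a fun _ => ⊥, henc.extend_apply a _⟩

theorem dbu_closedUnderOps :
    ClosedUnderOps (Set.range fun (t : dbuLang.Term ℕ) (ω : ℕ → Four) => t.realize ω) := by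
  constructor
  · rintro _ ⟨s, rfl⟩ _ ⟨t, rfl⟩
    exact ⟨Functions.apply₂ (L := dbuLang) DBuFunc.jk s t, funext fun ω => rfl⟩
  · rintro _ ⟨s, rfl⟩ _ ⟨t, rfl⟩
    exact ⟨Functions.apply₂ (L := dbuLang) DBuFunc.mk s t, funext fun ω => rfl⟩
  · rintro _ ⟨s, rfl⟩ _ ⟨t, rfl⟩
    exact ⟨Functions.apply₂ (L := dbuLang) DBuFunc.jt s t, funext fun ω => rfl⟩
  · rintro _ ⟨s, rfl⟩ _ ⟨t, rfl⟩
    exact ⟨Functions.apply₂ (L := dbuLang) DBuFunc.mt s t, funext fun ω => rfl⟩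
  · rintro _ ⟨s, rfl⟩
    exact ⟨Functions.apply₁ (L := dbuLang) DBuFunc.neg s, funext fun ω => rfl⟩

theorem realize_kJoinTerm (s t : dbLang.Term ℕ) (ω : ℕ → Four) :
    (kJoinTerm s t).realize ω = s.realize ω ⊔ t.realize ω :=
  Four.kJoin_eq _ _

theorem realize_kMeetTerm (s t : dbLang.Term ℕ) (ω : ℕ → Four) :
    (kMeetTerm s t).realize ω = s.realize ω ⊓ t.realize ω :=
  Four.kMeet_eq _ _

theorem db_closedUnderOps :
    ClosedUnderOps (Set.range fun (t : dbLang.Term ℕ) (ω : ℕ → Four) => t.realize ω) := by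
  constructor
  · rintro _ ⟨s, rfl⟩ _ ⟨t, rfl⟩
    exact ⟨kJoinTerm s t, funext fun ω => realize_kJoinTerm s t ω⟩
  · rintro _ ⟨s, rfl⟩ _ ⟨t, rfl⟩
    exact ⟨kMeetTerm s t, funext fun ω => realize_kMeetTerm s t ω⟩
  · rintro _ ⟨s, rfl⟩ _ ⟨t, rfl⟩
    exact ⟨tJoinTerm s t, funext fun ω => rfl⟩
  · rintro _ ⟨s, rfl⟩ _ ⟨t, rfl⟩
    exact ⟨tMeetTerm s t, funext fun ω => rfl⟩
  · rintro _ ⟨s, rfl⟩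
    exact ⟨Functions.apply₁ (L := dbLang) DBFunc.neg s, funext fun ω => rfl⟩

/-- In a closed set of functions, those taking the value `⊥` where all of the `x p` do, and `⊤`
where all of the `x p` do. -/
theorem ClosedUnderOps.idempotent {Ω : Type} {T : Set (Ω → Four)} (hT : ClosedUnderOps T)
    {ι : Type} (x : ι → Ω → Four) :
    ClosedUnderOps {t ∈ T | ∀ ω, ((∀ p, x p ω = ⊥) → t ω = ⊥) ∧ ((∀ p, x p ω = ⊤) → t ω = ⊤)} := by
  constructor
  · rintro f ⟨hf, hf'⟩ g ⟨hg, hg'⟩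
    exact ⟨hT.sup f hf g hg, fun ω => ⟨fun h => by simp [(hf' ω).1 h, (hg' ω).1 h],
      fun h => by simp [(hf' ω).2 h, (hg' ω).2 h]⟩⟩
  · rintro f ⟨hf, hf'⟩ g ⟨hg, hg'⟩
    exact ⟨hT.inf f hf g hg, fun ω => ⟨fun h => by simp [(hf' ω).1 h, (hg' ω).1 h],
      fun h => by simp [(hf' ω).2 h, (hg' ω).2 h]⟩⟩
  · rintro f ⟨hf, hf'⟩ g ⟨hg, hg'⟩
    exact ⟨hT.jt f hf g hg, fun ω => ⟨fun h => by simp only [(hf' ω).1 h, (hg' ω).1 h]; rfl,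
      fun h => by simp only [(hf' ω).2 h, (hg' ω).2 h]; rfl⟩⟩
  · rintro f ⟨hf, hf'⟩ g ⟨hg, hg'⟩
    exact ⟨hT.mt f hf g hg, fun ω => ⟨fun h => by simp only [(hf' ω).1 h, (hg' ω).1 h]; rfl,
      fun h => by simp only [(hf' ω).2 h, (hg' ω).2 h]; rfl⟩⟩
  · rintro f ⟨hf, hf'⟩
    exact ⟨hT.neg f hf, fun ω => ⟨fun h => by simp only [(hf' ω).1 h]; rfl,
      fun h => by simp only [(hf' ω).2 h]; rfl⟩⟩

end Clones

section Selector

/-- Which switches are on depends on `ω` alone, so the three outcomes are uniform in `i`. This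
uniformity lets a single homomorphism account for all variables. -/
theorem ClosedUnderOps.exists_selector_family {Ω : Type} {T : Set (Ω → Four)}
    (hT : ClosedUnderOps T) {ι κ : Type} [Finite ι] {x : ι → Ω → Four} (hx : ∀ p, x p ∈ T)
    {K0 K1 : Ω → Four} (hK0 : K0 ∈ T) (hK1 : K1 ∈ T) (w : ι → κ → Four) :
    ∃ t : κ → Ω → Four, (∀ i, t i ∈ T) ∧ ∀ ω, K0 ω = ⊥ → K1 ω = ⊤ →
      ((∀ i, t i ω = ⊥) ∨ (∃ p, ∀ i, t i ω = w p i) ∨ (∀ i, t i ω = ⊤)) ∧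
      ∀ p, (∀ q, x q ω = ⊤ ↔ q = p) → ∀ i, t i ω = w p i := by
  have := Fintype.ofFinite ι
  choose t htT ht using fun i => hT.exists_selector hx hK0 hK1 fun p => w p i
  refine ⟨t, htT, fun ω h0 h1 => ⟨?_, fun p hp i => (ht i ω h0 h1).2.1 p hp⟩⟩
  by_cases h : ∃ p, x p ω = ⊤
  · obtain ⟨p, hp⟩ := h
    by_cases h' : ∃ q, p ≠ q ∧ x q ω = ⊤
    · obtain ⟨q, hpq, hq⟩ := h'
      exact Or.inr (Or.inr fun i => (ht i ω h0 h1).2.2 p q hpq hp hq)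
    · refine Or.inr (Or.inl ⟨p, fun i => (ht i ω h0 h1).2.1 p fun q => ⟨fun hq => ?_, ?_⟩⟩)
      · by_contra hqp
        exact h' ⟨q, Ne.symm hqp, hq⟩
      · rintro rfl
        exact hp
  · exact Or.inl fun i => (ht i ω h0 h1).1 fun p hp => h ⟨p, hp⟩

end Selector

/-! ### Encoding homomorphisms by terms in the unbounded case -/

section Unbounded

variable {A : Type u} [dbuLang.Structure A]

/-- The constant homomorphism to an element of `Four` fixed by negation. -/
def dbuConstHom (A : Type u) [dbuLang.Structure A] (a : Four) (ha : Four.neg a = a) :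
    A →[dbuLang] Four where
  toFun _ := a
  map_fun' {n} g x := by
    have hj : ∀ a : Four, Four.jt a a = a := by decide
    have hm : ∀ a : Four, Four.mt a a = a := by decide
    cases g
    · exact (hj a).symm
    · exact (hm a).symm
    · exact (sup_idem a).symm
    · exact (inf_idem a).symm
    · exact ha.symm
  map_rel' r := isEmptyElim r

theorem dbu_exists_terms (ι : Type) [Finite ι] (h : ι → (A →[dbuLang] Four)) (v : ℕ → A) :
    ∃ τ : ℕ → dbuLang.Term ℕ,
      (∀ ω : ℕ → Four, ∃ g : A →[dbuLang] Four, ∀ i, (τ i).realize ω = g (v i)) ∧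
      ∀ p, ∃ ω : ℕ → Four, ∀ i, (τ i).realize ω = h p (v i) := by
  classical
  have := Fintype.ofFinite ι
  let gBot : A →[dbuLang] Four := dbuConstHom A ⊥ rfl
  let gTop : A →[dbuLang] Four := dbuConstHom A ⊤ rfl
  -- The extra switch `none` keeps the index type non-empty, and leaving it off makes the
  -- assignments that select `some p` non-constant.
  let h' : Option ι → (A →[dbuLang] Four) := fun p => p.elim gBot h
  obtain ⟨enc, henc⟩ := exists_injective_nat (Option ι)
  let x : Option ι → (ℕ → Four) → Four := fun p ω => ω (enc p)
  have hT := dbu_closedUnderOps.idempotent x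
  set T := {t ∈ Set.range fun (t : dbuLang.Term ℕ) (ω : ℕ → Four) => t.realize ω |
    ∀ ω, ((∀ p, x p ω = ⊥) → t ω = ⊥) ∧ ((∀ p, x p ω = ⊤) → t ω = ⊤)}
  have hx : ∀ p, x p ∈ T := fun p =>
    ⟨⟨Term.var (enc p), rfl⟩, fun ω => ⟨fun h => h p, fun h => h p⟩⟩
  let d : Option ι → (ℕ → Four) → Four := fun p => x p ⊓ fun ω => Four.neg (x p ω)
  let d' : Option ι → (ℕ → Four) → Four := fun p => x p ⊔ fun ω => Four.neg (x p ω)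
  -- Without constants, these terms replace `⊥` and `⊤`. They are correct unless all switches equal
  -- `⊤`, or all equal `⊥`, respectively.
  have hK0 := inf_finset_inf_mem hT.inf (hx none) Finset.univ d
    fun p _ => hT.inf _ (hx p) _ (hT.neg _ (hx p))
  have hK1 := sup_finset_sup_mem hT.sup (hx none) Finset.univ d'
    fun p _ => hT.sup _ (hx p) _ (hT.neg _ (hx p))
  have hbot : ∀ ω p, x p ω ≠ ⊤ → (x none ⊓ Finset.univ.inf d) ω = ⊥ := by
    intro ω p hp
    have h1 : (x none ⊓ Finset.univ.inf d) ω ≤ d p ω :=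
      inf_le_of_right_le (Finset.inf_le (f := d) (Finset.mem_univ p)) ω
    have h2 : ∀ a : Four, a ≠ ⊤ → a ⊓ Four.neg a = ⊥ := by decide
    exact le_bot_iff.1 (h1.trans (h2 _ hp).le)
  have htop : ∀ ω p, x p ω ≠ ⊥ → (x none ⊔ Finset.univ.sup d') ω = ⊤ := by
    intro ω p hp
    have h1 : d' p ω ≤ (x none ⊔ Finset.univ.sup d') ω :=
      le_sup_of_le_right (Finset.le_sup (f := d') (Finset.mem_univ p)) ω
    have h2 : ∀ a : Four, a ≠ ⊥ → a ⊔ Four.neg a = ⊤ := by decide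
    exact top_le_iff.1 ((h2 _ hp).ge.trans h1)
  obtain ⟨t, htT, ht⟩ := hT.exists_selector_family hx hK0 hK1 fun p i => h' p (v i)
  choose τ hτ using fun i => (htT i).1
  refine ⟨τ, fun ω => ?_, fun p => ?_⟩
  · simp only [fun i => congrFun (hτ i) ω]
    -- In the two cases where a substitute bound can fail, membership in `T` already gives a
    -- constant homomorphism.
    by_cases h1 : ∀ p, x p ω = ⊥
    · exact ⟨gBot, fun i => ((htT i).2 ω).1 h1⟩
    by_cases h2 : ∀ p, x p ω = ⊤
    · exact ⟨gTop, fun i => ((htT i).2 ω).2 h2⟩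
    push Not at h1 h2
    obtain ⟨p, hp⟩ := h1
    obtain ⟨q, hq⟩ := h2
    rcases (ht ω (hbot ω q hq) (htop ω p hp)).1 with h3 | ⟨r, h3⟩ | h3
    · exact ⟨gBot, h3⟩
    · exact ⟨h' r, h3⟩
    · exact ⟨gTop, h3⟩
  · obtain ⟨ω, hω⟩ := exists_assignment henc fun q => if q = some p then ⊤ else ⊥
    have hxω : ∀ q, x q ω = if q = some p then ⊤ else ⊥ := hω
    refine ⟨ω, fun i => (congrFun (hτ i) ω).trans ?_⟩
    refine (ht ω (hbot ω none (by simp [hxω])) (htop ω (some p) (by simp [hxω]))).2 (some p)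
      (fun q => ?_) i
    rw [hxω]
    split_ifs with hq <;> simp [hq]

end Unbounded

/-! ### The three clauses and the bounded case -/

section Bounded

theorem Four.realize_mono (t : dbLang.Term ℕ) : Monotone fun ω : ℕ → Four => t.realize ω := by
  have hj : ∀ a b c d : Four, a ≤ c → b ≤ d → Four.jt a b ≤ Four.jt c d := by decide
  have hm : ∀ a b c d : Four, a ≤ c → b ≤ d → Four.mt a b ≤ Four.mt c d := by decide
  have hn : ∀ a b : Four, a ≤ b → Four.neg a ≤ Four.neg b := by decide
  intro ω ω' hω
  induction t with
  | var i => exact hω i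
  | func f ts ih =>
    cases f
    · exact hj _ _ _ _ (ih 0) (ih 1)
    · exact hm _ _ _ _ (ih 0) (ih 1)
    · exact hn _ _ (ih 0)
    all_goals exact le_rfl

/-- At the `k`-greatest assignment, one of the two terms has second coordinate `false`. By
monotonicity it keeps this coordinate everywhere, while the meet forces its first coordinate to be
`true`. -/
theorem clauseMeet_admissible : clauseMeet.Admissible DB.{u} := by
  refine (db_fourGenerates.admissible_iff _).2 fun τ h => ?_
  have h' : ∀ ω : ℕ → Four, (τ 0).realize ω ⊓ (τ 1).realize ω = (true, false) := fun ω =>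
    (realize_kMeetTerm _ _ _).symm.trans (h _ (Finset.mem_singleton_self _) ω)
  have key : ∀ a b c : Four, a ⊓ b = (true, false) → a ≤ c → c.2 = false →
      a = (true, false) := by decide
  have hor : ∀ a b : Four, a ⊓ b = (true, false) → a.2 = false ∨ b.2 = false := by decide
  rcases hor _ _ (h' ⊤) with h2 | h2
  · exact ⟨(xVar, t1Term), by simp [clauseMeet], fun ω =>
      key _ _ _ (h' ω) (Four.realize_mono (τ 0) le_top) h2⟩
  · exact ⟨(yVar, t1Term), by simp [clauseMeet], fun ω =>
      key _ _ _ ((inf_comm _ _).trans (h' ω)) (Four.realize_mono (τ 1) le_top) h2⟩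

theorem clauseJoin_admissible : clauseJoin.Admissible DB.{u} := by
  refine (db_fourGenerates.admissible_iff _).2 fun τ h => ?_
  have h' : ∀ ω : ℕ → Four, (τ 0).realize ω ⊔ (τ 1).realize ω = (true, false) := fun ω =>
    (realize_kJoinTerm _ _ _).symm.trans (h _ (Finset.mem_singleton_self _) ω)
  have key : ∀ a b c : Four, a ⊔ b = (true, false) → c ≤ a → c.1 = true →
      a = (true, false) := by decide
  have hor : ∀ a b : Four, a ⊔ b = (true, false) → a.1 = true ∨ b.1 = true := by decide
  rcases hor _ _ (h' ⊥) with h2 | h2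
  · exact ⟨(xVar, t1Term), by simp [clauseJoin], fun ω =>
      key _ _ _ (h' ω) (Four.realize_mono (τ 0) bot_le) h2⟩
  · exact ⟨(yVar, t1Term), by simp [clauseJoin], fun ω =>
      key _ _ _ ((sup_comm _ _).trans (h' ω)) (Four.realize_mono (τ 1) bot_le) h2⟩

theorem clauseNontrivial_admissible : clauseNontrivial.Admissible DB.{u} := by
  refine (db_fourGenerates.admissible_iff _).2 fun τ h => ?_
  have := h _ (Finset.mem_singleton_self _) ⊥
  exact absurd (show ((false, true) : Four) = (true, false) from this) (by decide)

variable {A : Type u} [dbLang.Structure A]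

theorem realize_eq_of_hom (hA : DB A) (s t : dbLang.Term ℕ) (v : ℕ → A)
    (h : ∀ g : A →[dbLang] Four, s.realize (g ∘ v) = t.realize (g ∘ v)) :
    s.realize v = t.realize v := by
  by_contra hne
  obtain ⟨g, hg⟩ := db_exists_hom_separating hA hne
  exact hg (by rw [← HomClass.realize_term, ← HomClass.realize_term, h])

theorem hom_eq_top_of_eq {a : A} {v : ℕ → A} (h : a = t1Term.realize v) (g : A →[dbLang] Four) :
    g a = (true, false) := by
  rw [h, ← HomClass.realize_term]
  rfl

theorem hom_top_or_of_clauseJoin (hA : DB A) (hc : clauseJoin.Holds A) (a b : A)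
    (h : ∀ g : A →[dbLang] Four, g a ⊔ g b = (true, false)) :
    (∀ g : A →[dbLang] Four, g a = (true, false)) ∨
      ∀ g : A →[dbLang] Four, g b = (true, false) := by
  obtain ⟨e, he, h'⟩ := hc (fun n => if n = 0 then a else b) fun e he => by
    rw [Finset.mem_singleton.1 he]
    exact realize_eq_of_hom hA _ _ _ fun g => (realize_kJoinTerm _ _ _).trans (h g)
  simp only [clauseJoin, Finset.mem_insert, Finset.mem_singleton] at he
  rcases he with rfl | rfl
  · exact Or.inl (hom_eq_top_of_eq h')
  · exact Or.inr (hom_eq_top_of_eq h')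

theorem hom_top_or_of_clauseMeet (hA : DB A) (hc : clauseMeet.Holds A) (a b : A)
    (h : ∀ g : A →[dbLang] Four, g a ⊓ g b = (true, false)) :
    (∀ g : A →[dbLang] Four, g a = (true, false)) ∨
      ∀ g : A →[dbLang] Four, g b = (true, false) := by
  obtain ⟨e, he, h'⟩ := hc (fun n => if n = 0 then a else b) fun e he => by
    rw [Finset.mem_singleton.1 he]
    exact realize_eq_of_hom hA _ _ _ fun g => (realize_kMeetTerm _ _ _).trans (h g)
  simp only [clauseMeet, Finset.mem_insert, Finset.mem_singleton] at he
  rcases he with rfl | rfl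
  · exact Or.inl (hom_eq_top_of_eq h')
  · exact Or.inr (hom_eq_top_of_eq h')

/-- Without homomorphisms to separate them, `0_t` and `1_t` would coincide. -/
theorem nonempty_hom_of_clauseNontrivial (hA : DB A) (hc : clauseNontrivial.Holds A)
    (a : A) : Nonempty (A →[dbLang] Four) := by
  by_contra hne
  obtain ⟨e, he, -⟩ := hc (fun _ => a) fun e he => by
    rw [Finset.mem_singleton.1 he]
    exact realize_eq_of_hom hA _ _ _ fun g => (hne ⟨g⟩).elim
  simp [clauseNontrivial] at he

theorem hom_jt (g : A →[dbLang] Four) (a b : A) :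
    g (Structure.funMap (L := dbLang) DBFunc.jt ![a, b]) = Four.jt (g a) (g b) :=
  g.map_fun _ _

theorem hom_mt (g : A →[dbLang] Four) (a b : A) :
    g (Structure.funMap (L := dbLang) DBFunc.mt ![a, b]) = Four.mt (g a) (g b) :=
  g.map_fun _ _

theorem hom_neg (g : A →[dbLang] Four) (a : A) :
    g (Structure.funMap (L := dbLang) DBFunc.neg ![a]) = Four.neg (g a) :=
  g.map_fun _ _

theorem hom_t0 (g : A →[dbLang] Four) :
    g (Structure.funMap (L := dbLang) DBFunc.t0 ![]) = (false, true) :=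
  g.map_fun _ _

theorem hom_t1 (g : A →[dbLang] Four) :
    g (Structure.funMap (L := dbLang) DBFunc.t1 ![]) = (true, false) :=
  g.map_fun _ _

theorem hom_k0 (g : A →[dbLang] Four) :
    g (Structure.funMap (L := dbLang) DBFunc.k0 ![]) = (false, false) :=
  g.map_fun _ _

theorem hom_k1 (g : A →[dbLang] Four) :
    g (Structure.funMap (L := dbLang) DBFunc.k1 ![]) = (true, true) :=
  g.map_fun _ _

/-- Under the join clause, the homomorphisms to `Four` have a pointwise `k`-least element. -/
theorem exists_least_hom (hA : DB A) (hJ : clauseJoin.Holds A) [Nonempty (A →[dbLang] Four)] :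
    ∃ g₀ : A →[dbLang] Four, ∀ (g : A →[dbLang] Four) a, g₀ a ≤ g a := by
  classical
  -- The `t`-join with `0_k` sends the second coordinate to `false` and keeps the first, so equality
  -- with `1_t` tests the first coordinate alone.
  have hJ' : ∀ a b : A, (∀ g : A →[dbLang] Four, (g a).1 = true ∨ (g b).1 = true) →
      (∀ g : A →[dbLang] Four, (g a).1 = true) ∨ ∀ g : A →[dbLang] Four, (g b).1 = true := by
    intro a b h
    have := hom_top_or_of_clauseJoin hA hJ
      (Structure.funMap (L := dbLang) DBFunc.jt
        ![a, Structure.funMap (L := dbLang) DBFunc.k0 ![] ])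
      (Structure.funMap (L := dbLang) DBFunc.jt
        ![b, Structure.funMap (L := dbLang) DBFunc.k0 ![] ])
      (fun g => by
        rw [hom_jt, hom_jt, hom_k0]
        have := h g
        simpa [Four.jt] using this)
    simpa only [hom_jt, hom_k0, Four.jt, Prod.mk.injEq, Bool.or_false, Bool.and_false,
      and_true] using this
  -- The pointwise infimum of all first coordinates. It respects `t`-meets automatically; `t`-joins
  -- need the clause.
  refine ⟨dbHom hA (fun a => decide (∀ g : A →[dbLang] Four, (g a).1 = true)) ?_ ?_ ?_ ?_ ?_ ?_,
    fun g a => ⟨?_, ?_⟩⟩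
  · intro a b
    rw [Bool.eq_iff_iff]
    simp only [hom_jt, Four.jt, Bool.or_eq_true, decide_eq_true_eq]
    exact ⟨hJ' a b, fun h g => h.imp (fun h => h g) (fun h => h g)⟩
  · intro a b
    rw [Bool.eq_iff_iff]
    simp only [hom_mt, Four.mt, Bool.and_eq_true, decide_eq_true_eq]
    exact forall_and
  · simp [hom_t0, -Hom.map_fun]
  · simp [hom_t1, -Hom.map_fun]
  · simp [hom_k0, -Hom.map_fun]
  · simp [hom_k1, -Hom.map_fun]
  · exact Bool.le_iff_imp.2 fun h => of_decide_eq_true h g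
  · refine Bool.le_iff_imp.2 fun h => ?_
    have := of_decide_eq_true h g
    rwa [hom_neg] at this

/-- Under the meet clause, the homomorphisms to `Four` have a pointwise `k`-greatest element. -/
theorem exists_greatest_hom (hA : DB A) (hM : clauseMeet.Holds A)
    [Nonempty (A →[dbLang] Four)] :
    ∃ g₁ : A →[dbLang] Four, ∀ (g : A →[dbLang] Four) a, g a ≤ g₁ a := by
  classical
  have hM' : ∀ a b : A, (∀ g : A →[dbLang] Four, (g a).1 = false ∨ (g b).1 = false) →
      (∀ g : A →[dbLang] Four, (g a).1 = false) ∨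
        ∀ g : A →[dbLang] Four, (g b).1 = false := by
    intro a b h
    -- The value of `¬(a ∧_t 1_k)` is `(true, (g a).1)`, which equals `1_t` exactly when the first
    -- coordinate of `g a` is `false`.
    have := hom_top_or_of_clauseMeet hA hM
      (Structure.funMap (L := dbLang) DBFunc.neg ![Structure.funMap (L := dbLang) DBFunc.mt
        ![a, Structure.funMap (L := dbLang) DBFunc.k1 ![] ] ])
      (Structure.funMap (L := dbLang) DBFunc.neg ![Structure.funMap (L := dbLang) DBFunc.mt
        ![b, Structure.funMap (L := dbLang) DBFunc.k1 ![] ] ])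
      (fun g => by
        rw [hom_neg, hom_neg, hom_mt, hom_mt, hom_k1]
        have := h g
        cases h1 : (g a).1 <;> cases h2 : (g b).1 <;> simp_all [Four.mt, Four.neg])
    simpa only [hom_neg, hom_mt, hom_k1, Four.mt, Four.neg, Prod.mk.injEq, Bool.or_true,
      Bool.and_true, true_and] using this
  refine ⟨dbHom hA (fun a => decide (∃ g : A →[dbLang] Four, (g a).1 = true)) ?_ ?_ ?_ ?_ ?_ ?_,
    fun g a => ⟨?_, ?_⟩⟩
  · intro a b
    rw [Bool.eq_iff_iff]
    simp only [hom_jt, Four.jt, Bool.or_eq_true, decide_eq_true_eq]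
    exact exists_or
  · intro a b
    rw [Bool.eq_iff_iff]
    simp only [hom_mt, Four.mt, Bool.and_eq_true, decide_eq_true_eq]
    refine ⟨fun ⟨g, h1, h2⟩ => ⟨⟨g, h1⟩, ⟨g, h2⟩⟩, fun ⟨⟨g, hg⟩, ⟨g', hg'⟩⟩ => ?_⟩
    by_contra! hne
    rcases hM' a b fun g => by
      by_cases h : (g a).1 = true
      · exact Or.inr (Bool.eq_false_iff.2 (hne g h))
      · exact Or.inl (Bool.eq_false_iff.2 h) with h | h
    · simp [h] at hg
    · simp [h] at hg'
  · simp [hom_t0, -Hom.map_fun]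
  · simp [hom_t1, -Hom.map_fun]
  · simp [hom_k0, -Hom.map_fun]
  · simp [hom_k1, -Hom.map_fun]
  · exact Bool.le_iff_imp.2 fun h => decide_eq_true ⟨g, h⟩
  · refine Bool.le_iff_imp.2 fun h => decide_eq_true ⟨g, ?_⟩
    rwa [hom_neg]

/-- Clipping a selector between the constants for `g₀ (v i)` and `g₁ (v i)` turns the outcomes `⊥`
and `⊤` into `g₀` and `g₁`, and leaves every `h p` unchanged. -/
theorem db_exists_terms {g₀ g₁ : A →[dbLang] Four} (h₀ : ∀ (g : A →[dbLang] Four) a, g₀ a ≤ g a)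
    (h₁ : ∀ (g : A →[dbLang] Four) a, g a ≤ g₁ a)
    (ι : Type) [Finite ι] (h : ι → (A →[dbLang] Four)) (v : ℕ → A) :
    ∃ τ : ℕ → dbLang.Term ℕ,
      (∀ ω : ℕ → Four, ∃ g : A →[dbLang] Four, ∀ i, (τ i).realize ω = g (v i)) ∧
      ∀ p, ∃ ω : ℕ → Four, ∀ i, (τ i).realize ω = h p (v i) := by
  classical
  have hT := db_closedUnderOps
  obtain ⟨enc, henc⟩ := exists_injective_nat ι
  obtain ⟨t, htT, ht⟩ := hT.exists_selector_family (x := fun p ω => ω (enc p))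
    (K0 := fun _ => ⊥) (K1 := fun _ => ⊤) (fun p => ⟨Term.var (enc p), rfl⟩)
    ⟨k0Term, rfl⟩ ⟨k1Term, rfl⟩ fun p i => h p (v i)
  choose σ hσ using htT
  choose c hc using exists_constant_term
  have hτ : ∀ i (ω : ℕ → Four),
      (kMeetTerm (kJoinTerm (σ i) (c (g₀ (v i)))) (c (g₁ (v i)))).realize ω =
        (t i ω ⊔ g₀ (v i)) ⊓ g₁ (v i) := by
    intro i ω
    rw [realize_kMeetTerm, realize_kJoinTerm, hc, hc, ← hσ]
  refine ⟨fun i => kMeetTerm (kJoinTerm (σ i) (c (g₀ (v i)))) (c (g₁ (v i))), fun ω => ?_,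
    fun p => ?_⟩
  · simp only [hτ]
    rcases (ht ω rfl rfl).1 with h' | ⟨p, h'⟩ | h'
    · exact ⟨g₀, fun i => by rw [h', bot_sup_eq, inf_eq_left.2 (h₁ _ _)]⟩
    · exact ⟨h p, fun i => by rw [h', sup_eq_left.2 (h₀ _ _), inf_eq_left.2 (h₁ _ _)]⟩
    · exact ⟨g₁, fun i => by rw [h', top_sup_eq, top_inf_eq]⟩
  · obtain ⟨ω, hω⟩ := exists_assignment henc fun q => if q = p then ⊤ else ⊥
    refine ⟨ω, fun i => ?_⟩
    rw [hτ, (ht ω rfl rfl).2 p (fun q => by rw [hω]; split_ifs with hq <;> simp [hq]) i,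
      sup_eq_left.2 (h₀ _ _), inf_eq_left.2 (h₁ _ _)]

end Bounded

theorem valid_of_admissible_dbu {c : Clause dbuLang} (hc : c.Admissible DBu.{u}) :
    c.Valid DBu.{u} := fun _ _ _ hA =>
  dbu_fourGenerates.holds_of_admissible (fun _ _ => dbu_exists_hom_separating hA)
    dbu_exists_terms hc

theorem isBasisAdmissibleClauses_db :
    IsBasisAdmissibleClauses DB.{u} {clauseMeet, clauseJoin, clauseNontrivial} := by
  intro A _ hne hA
  constructor
  · intro h c hc
    have : Nonempty (A →[dbLang] Four) :=
      nonempty_hom_of_clauseNontrivial hA (h _ (by simp)) hne.some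
    obtain ⟨g₀, h₀⟩ := exists_least_hom hA (h _ (by simp))
    obtain ⟨g₁, h₁⟩ := exists_greatest_hom hA (h _ (by simp))
    exact db_fourGenerates.holds_of_admissible (fun _ _ => db_exists_hom_separating hA)
      (db_exists_terms h₀ h₁) hc
  · rintro h c (rfl | rfl | rfl)
    · exact h _ clauseMeet_admissible
    · exact h _ clauseJoin_admissible
    · exact h _ clauseNontrivial_admissible

end Bilat

theorem theorem8p3 :
    (∀ c : Bilat.Clause Bilat.dbLang, c.IsQuasiIdentity →
      c.Admissible Bilat.DB.{u} → c.Valid Bilat.DB.{u}) ∧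
    Bilat.IsBasisAdmissibleClauses Bilat.DB.{u}
      {Bilat.clauseMeet, Bilat.clauseJoin, Bilat.clauseNontrivial} ∧
    (∀ c : Bilat.Clause Bilat.dbuLang,
      c.Admissible Bilat.DBu.{u} → c.Valid Bilat.DBu.{u}) :=
  ⟨fun _ => Bilat.valid_of_admissible_of_isQuasiIdentity, Bilat.isBasisAdmissibleClauses_db,
    fun _ => Bilat.valid_of_admissible_dbu⟩
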